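/- Let $(Z_t)_{t\ge 0}$ be a continuous-time Markov chain whose states are the finite subsets of the square lattice $\mathbb{Z}^2$ (with nearest-neighbour adjacency), started at $Z_0=\{\mathbf 0\}$, where $\mathbf 0$ is the origin. Say that a vertex $v$ is adjacent to a finite set $S$ if $v\notin S$ and $v$ has a neighbour in $S$. Suppose that the only possible transitions are $S\to S\cup\{v\}$ with $v$ adjacent to $S$, and that there are constants $c_*, c^*$ such that the transition rates satisfy $$0<c_*\le q(S,S\cup\{v\})\le c^*<\infty$$ for every finite $S$ and every $v$ adjacent to $S$, and $$q(S,S\cup\{v\})\le q(S\cup\{v'\},S\cup\{v,v'\})$$ for every finite $S$ and all distinct $v,v'$ adjacent to $S$. Let $A$ be a non-empty subset of $\mathbb{Z}^2\setminus\{\mathbf 0\}$ and let $T:=\inf\{t\ge 0: Z_t\cap A\neq\emptyset\}$. Then $T$ is almost surely finite, has finite second moment, and $$\operatorname{var} T\le \frac{\mathbb{E}\,T}{c_*}.$$ -/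

import Mathlib

open MeasureTheory ProbabilityTheory
open scoped NNReal ENNReal

noncomputable section

namespace MarkovGrowth

section Chain

variable {E Ω : Type*}

/-- The total rate of leaving `x`, the sum of `q x y` over `y ≠ x`, where `q x y` is the rate of
jumping from `x` to `y`. (The diagonal of `q` plays no role.) -/
def exitRate (q : E → E → ℝ) (x : E) : ℝ := ∑' y : {y : E // y ≠ x}, q x y

open Classical in
/-- The transition probabilities of the jump chain; a state with exit rate `0` is absorbing. -/
def jumpProb (q : E → E → ℝ) (x y : E) : ℝ :=
  if exitRate q x = 0 then (if y = x then 1 else 0)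
  else (if y = x then 0 else q x y / exitRate q x)

/-- The information in the first visited states `Y 0, …, Y n` and in the holding times
`τ 0, …, τ (n - 1)` of all of these states but the last. States carry the discrete σ-algebra. -/
abbrev history (Y : ℕ → Ω → E) (τ : ℕ → Ω → ℝ≥0∞) (n : ℕ) : MeasurableSpace Ω :=
  (⨆ k ∈ Set.Iic n, MeasurableSpace.comap (Y k) ⊤) ⊔
    (⨆ k ∈ Set.Iio n, MeasurableSpace.comap (τ k) inferInstance)

/-- `Y` is the sequence of successive states and `τ` the sequence of holding times of a
continuous-time Markov chain with jump rates `q` started at `x₀`: given the history up to the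
arrival in the `n`-th state `x = Y n`, the holding time `τ n` is exponential with parameter
`exitRate q x` (it is `∞` if that rate is `0`), and, independently of it, the next state is `y`
with probability `jumpProb q x y`. -/
structure IsJumpHolding [MeasurableSpace Ω] (P : Measure Ω) (q : E → E → ℝ) (x₀ : E)
    (Y : ℕ → Ω → E) (τ : ℕ → Ω → ℝ≥0∞) : Prop where
  measurable_state : ∀ n, Measurable[_, ⊤] (Y n)
  measurable_hold : ∀ n, Measurable (τ n)
  init : ∀ᵐ ω ∂P, Y 0 ω = x₀
  step : ∀ (n : ℕ) (H : Set Ω), MeasurableSet[history Y τ n] H → ∀ (x y : E) (t : ℝ≥0),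
    P (H ∩ {ω | Y n ω = x ∧ Y (n + 1) ω = y ∧ (t : ℝ≥0∞) < τ n ω}) =
      P (H ∩ {ω | Y n ω = x}) *
        ENNReal.ofReal (jumpProb q x y * Real.exp (-(exitRate q x * t)))

/-- `Z` is a (right-continuous) continuous-time Markov chain with jump rates `q` started at `x₀`:
it stays in the `n`-th state `Y n` of its jump chain from the time `τ 0 + ⋯ + τ (n - 1)` of the
`n`-th jump, included, up to the time `τ 0 + ⋯ + τ n` of the next jump, excluded. Nothing is
required after the explosion time `∑ n, τ n`, should it be finite. -/
def IsMarkovChain [MeasurableSpace Ω] (P : Measure Ω) (q : E → E → ℝ) (x₀ : E)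
    (Z : ℝ≥0 → Ω → E) : Prop :=
  ∃ (Y : ℕ → Ω → E) (τ : ℕ → Ω → ℝ≥0∞), IsJumpHolding P q x₀ Y τ ∧
    ∀ᵐ ω ∂P, ∀ (n : ℕ) (t : ℝ≥0), ∑ k ∈ Finset.range n, τ k ω ≤ t →
      t < ∑ k ∈ Finset.range (n + 1), τ k ω → Z t ω = Y n ω

end Chain

/-- The vertices of the square lattice. -/
abbrev Vertex : Type := ℤ × ℤ

/-- Nearest-neighbour adjacency in the square lattice. -/
def LatticeAdj (u v : Vertex) : Prop := |u.1 - v.1| + |u.2 - v.2| = 1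

/-- The vertex `v` is adjacent to the set `S`: it lies outside `S` and has a neighbour in `S`. -/
def AdjTo (v : Vertex) (S : Finset Vertex) : Prop := v ∉ S ∧ ∃ u ∈ S, LatticeAdj u v

/-- `q` gives the transition rates of a growth process: the only possible transitions are
`S → S ∪ {v}` with `v` adjacent to `S`. -/
def IsGrowthRate (q : Finset Vertex → Finset Vertex → ℝ) : Prop :=
  ∀ S S' : Finset Vertex, S' ≠ S → (¬ ∃ v, AdjTo v S ∧ S' = insert v S) → q S S' = 0

/-- The rates of all possible transitions lie between `c` and `C`. -/
def RatesBounded (q : Finset Vertex → Finset Vertex → ℝ) (c C : ℝ) : Prop :=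
  ∀ (S : Finset Vertex) (v : Vertex), AdjTo v S → c ≤ q S (insert v S) ∧ q S (insert v S) ≤ C

/-- The rates are increasing in the current set: adding `v'` does not decrease the rate at
which another vertex `v` is added. -/
def RatesMonotone (q : Finset Vertex → Finset Vertex → ℝ) : Prop :=
  ∀ (S : Finset Vertex) (v v' : Vertex), AdjTo v S → AdjTo v' S → v ≠ v' →
    q S (insert v S) ≤ q (insert v' S) (insert v (insert v' S))

/-- The first time at which the growing set meets `A` (the infimum of the empty set is `∞`). -/
def hitTime {Ω : Type*} (Z : ℝ≥0 → Ω → Finset Vertex) (A : Set Vertex) (ω : Ω) : ℝ≥0∞ :=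
  ⨅ t ∈ {t : ℝ≥0 | ((Z t ω : Set Vertex) ∩ A).Nonempty}, (t : ℝ≥0∞)

end MarkovGrowth

end

/-! Let h(S) be the mean time needed to meet A from the set S. As long as S misses A, h decreases at
mean rate 1: the sum over v of q(S, S ∪ {v}) (h(S) - h(S ∪ {v})) equals 1. Monotone rates make h
decreasing in S (`meanTime_insert_le`), so the terms of this sum are nonnegative and each is at most
1. As the rates are at least c, every jump lowers h by an amount between 0 and 1/c
(`meanTime_sub_le`).

The process t + h(Z_t), stopped at T, is a martingale leading from the constant E T to T itself. It
jumps only through the drops of h, so its quadratic variation grows at mean rate ∑ q (h(S) - h(S ∪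
{v}))² ≤ (1/c) ∑ q (h(S) - h(S ∪ {v})) = 1/c. Accumulated up to T this gives E T / c, which bounds
var T.

To avoid any prior finiteness, h is replaced by h_m (`meanTime`), which counts only the first m
states and is defined by recursion. A jump uses up one state, so h_{m+1}(S) is always compared with
h_m(S ∪ {v}). The martingale is followed along the jump chain, as active time in the first n states
plus h_m(Y n) with n + m fixed (`lintegral_martingale`, `lintegral_martingale_sq_le`); monotone
convergence then removes the truncation.

It remains to identify the total active time with T, although the chain is not known to be
non-explosive. The mean active time is finite, because h_m is at most the lattice distance to A
divided by c (`meanTime_le`). A chain that never met A would have active holding times with a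
divergent, harmonic sum of means; so A is met after finitely many jumps (`ae_exists_meets`,
`ae_hitTime_eq`). -/

namespace MarkovGrowth

/-! ### Boundaries in the lattice -/

/-- The outer vertex boundary of a finite set of vertices. -/
def boundary (S : Finset Vertex) : Finset Vertex :=
  (S.biUnion fun u => {(u.1 + 1, u.2), (u.1 - 1, u.2), (u.1, u.2 + 1), (u.1, u.2 - 1)}) \ S

lemma latticeAdj_iff (u v : Vertex) : LatticeAdj u v ↔
    v = (u.1 + 1, u.2) ∨ v = (u.1 - 1, u.2) ∨ v = (u.1, u.2 + 1) ∨ v = (u.1, u.2 - 1) := by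
  obtain ⟨a, b⟩ := u
  obtain ⟨x, y⟩ := v
  simp only [LatticeAdj, Prod.mk.injEq]
  rcases abs_cases (a - x) with h | h <;> rcases abs_cases (b - y) with h' | h' <;> omega

lemma mem_boundary {S : Finset Vertex} {v : Vertex} : v ∈ boundary S ↔ AdjTo v S := by
  simp only [boundary, AdjTo, latticeAdj_iff, Finset.mem_sdiff, Finset.mem_biUnion,
    Finset.mem_insert, Finset.mem_singleton]
  exact and_comm

lemma card_boundary_le (S : Finset Vertex) : (boundary S).card ≤ 4 * S.card := by
  refine (Finset.card_le_card Finset.sdiff_subset).trans ?_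
  rw [mul_comm]
  exact Finset.card_biUnion_le_card_mul _ _ _ fun u _ => Finset.card_le_four

lemma boundary_nonempty {S : Finset Vertex} (hS : S.Nonempty) : (boundary S).Nonempty := by
  -- The right-hand neighbour of a rightmost vertex lies outside `S`.
  obtain ⟨u, hu, hmax⟩ := S.exists_max_image Prod.fst hS
  refine ⟨(u.1 + 1, u.2), mem_boundary.2 ⟨fun h => ?_, u, hu, (latticeAdj_iff _ _).2 (Or.inl rfl)⟩⟩
  have := hmax _ h
  simp at this

lemma AdjTo.insert {S : Finset Vertex} {v w : Vertex} (hv : AdjTo v S) (hvw : v ≠ w) :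
    AdjTo v (insert w S) := by
  obtain ⟨hvS, u, hu, huv⟩ := hv
  exact ⟨by simp [hvS, hvw], u, Finset.mem_insert_of_mem hu, huv⟩

/-- A sum over all finite sets of a function that vanishes off the sets obtained from `S` by adding
a boundary vertex. -/
lemma tsum_eq_sum_boundary {M : Type*} [AddCommMonoid M] [TopologicalSpace M]
    {S : Finset Vertex} {F : Finset Vertex → M}
    (hF : ∀ S', (¬ ∃ v, AdjTo v S ∧ S' = insert v S) → F S' = 0) :
    ∑' S', F S' = ∑ v ∈ boundary S, F (insert v S) := by
  classical
  rw [tsum_eq_sum (s := (boundary S).image fun v => insert v S), Finset.sum_image]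
  · intro v hv w hw h
    have hv' := (mem_boundary.1 hv).1
    have : v ∈ Insert.insert w S := by
      rw [← show Insert.insert v S = Insert.insert w S from h]; exact Finset.mem_insert_self _ _
    simpa [hv'] using this
  · intro S' hS'
    refine hF S' ?_
    rintro ⟨v, hv, rfl⟩
    exact hS' (Finset.mem_image.2 ⟨v, mem_boundary.2 hv, rfl⟩)

/-! ### Exit rates and jump probabilities -/

section Rates

variable {q : Finset Vertex → Finset Vertex → ℝ} {c C : ℝ} {A : Set Vertex}

lemma insert_ne_of_adjTo {S : Finset Vertex} {v : Vertex} (hv : AdjTo v S) : insert v S ≠ S :=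
  fun h => hv.1 (h ▸ Finset.mem_insert_self v S)

lemma exitRate_eq (hq : IsGrowthRate q) (S : Finset Vertex) :
    exitRate q S = ∑ v ∈ boundary S, q S (insert v S) := by
  classical
  have h1 : exitRate q S = ∑' S', Set.indicator {S' | S' ≠ S} (q S) S' :=
    tsum_subtype {S' | S' ≠ S} (q S)
  rw [h1, tsum_eq_sum_boundary]
  · refine Finset.sum_congr rfl fun v hv => ?_
    rw [Set.indicator_of_mem]
    exact insert_ne_of_adjTo (mem_boundary.1 hv)
  · intro S' hS'
    by_cases h : S' = S
    · simp [h]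
    · rw [Set.indicator_of_mem h]
      exact hq S S' h hS'

lemma exitRate_pos (hq : IsGrowthRate q) (hc : 0 < c) (hb : RatesBounded q c C)
    {S : Finset Vertex} (hS : S.Nonempty) : 0 < exitRate q S := by
  rw [exitRate_eq hq]
  exact Finset.sum_pos (fun v hv => hc.trans_le (hb S v (mem_boundary.1 hv)).1)
    (boundary_nonempty hS)

lemma exitRate_le (hq : IsGrowthRate q) (hC : 0 ≤ C) (hb : RatesBounded q c C)
    (S : Finset Vertex) : exitRate q S ≤ 4 * C * S.card := by
  rw [exitRate_eq hq]
  calc ∑ v ∈ boundary S, q S (insert v S) ≤ (boundary S).card • C :=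
        Finset.sum_le_card_nsmul _ _ _ fun v hv => (hb S v (mem_boundary.1 hv)).2
    _ ≤ 4 * C * S.card := by
        have : ((boundary S).card : ℝ) ≤ 4 * S.card := by exact_mod_cast card_boundary_le S
        rw [nsmul_eq_mul]
        nlinarith

lemma jumpProb_insert {S : Finset Vertex} {v : Vertex} (hv : AdjTo v S)
    (hS : exitRate q S ≠ 0) : jumpProb q S (insert v S) = q S (insert v S) / exitRate q S := by
  rw [jumpProb, if_neg hS, if_neg (insert_ne_of_adjTo hv)]

lemma jumpProb_eq_zero (hq : IsGrowthRate q) {S S' : Finset Vertex}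
    (hS : exitRate q S ≠ 0) (h : ¬ ∃ v, AdjTo v S ∧ S' = insert v S) : jumpProb q S S' = 0 := by
  rw [jumpProb, if_neg hS]
  split_ifs with h'
  · rfl
  · rw [hq S S' h' h, zero_div]

lemma jumpProb_nonneg (hq : IsGrowthRate q) (hc : 0 < c) (hb : RatesBounded q c C)
    {S : Finset Vertex} (hS : S.Nonempty) (S' : Finset Vertex) : 0 ≤ jumpProb q S S' := by
  have hpos := exitRate_pos hq hc hb hS
  by_cases h : ∃ v, AdjTo v S ∧ S' = insert v S
  · obtain ⟨v, hv, rfl⟩ := h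
    rw [jumpProb_insert hv hpos.ne']
    exact div_nonneg (hc.le.trans (hb S v hv).1) hpos.le
  · rw [jumpProb_eq_zero hq hpos.ne' h]

lemma sum_jumpProb (hq : IsGrowthRate q) (hc : 0 < c) (hb : RatesBounded q c C)
    {S : Finset Vertex} (hS : S.Nonempty) :
    ∑ v ∈ boundary S, jumpProb q S (insert v S) = 1 := by
  have hpos := exitRate_pos hq hc hb hS
  rw [Finset.sum_congr rfl fun v hv => jumpProb_insert (mem_boundary.1 hv) hpos.ne',
    ← Finset.sum_div, ← exitRate_eq hq, div_self hpos.ne']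

/-- The weighted sum over all jumps of an `ℝ≥0∞`-valued function that comes from a nonnegative real
one. -/
lemma tsum_jumpProb_mul (hq : IsGrowthRate q) (hc : 0 < c) (hb : RatesBounded q c C)
    {S : Finset Vertex} (hS : S.Nonempty) {f : Finset Vertex → ℝ} (hf : ∀ S', 0 ≤ f S') :
    ∑' S', ENNReal.ofReal (jumpProb q S S') * ENNReal.ofReal (f S') =
      ENNReal.ofReal (∑ v ∈ boundary S, jumpProb q S (insert v S) * f (insert v S)) := by
  have hp := jumpProb_nonneg hq hc hb hS
  rw [tsum_eq_sum_boundary (S := S), ENNReal.ofReal_sum_of_nonneg]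
  · exact Finset.sum_congr rfl fun v _ => (ENNReal.ofReal_mul (hp _)).symm
  · exact fun v _ => mul_nonneg (hp _) (hf _)
  · intro S' hS'
    rw [jumpProb_eq_zero hq (exitRate_pos hq hc hb hS).ne' hS', ENNReal.ofReal_zero, zero_mul]

lemma tsum_jumpProb (hq : IsGrowthRate q) (hc : 0 < c) (hb : RatesBounded q c C)
    {S : Finset Vertex} (hS : S.Nonempty) :
    ∑' S', ENNReal.ofReal (jumpProb q S S') = 1 := by
  have := tsum_jumpProb_mul hq hc hb hS (f := fun _ => 1) fun _ => zero_le_one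
  simpa [sum_jumpProb hq hc hb hS] using this

/-! ### The truncated mean remaining time and its decrease along jumps -/

open Classical in
/-- The mean time that the chain with rates `q` started from `S` spends in its first `m` states
before it meets `A`. -/
noncomputable def meanTime (q : Finset Vertex → Finset Vertex → ℝ) (A : Set Vertex) :
    ℕ → Finset Vertex → ℝ
  | 0, _ => 0
  | m + 1, S =>
    if ((S : Set Vertex) ∩ A).Nonempty then 0
    else (1 + ∑ v ∈ boundary S, q S (insert v S) * meanTime q A m (insert v S)) / exitRate q S

lemma meanTime_of_meets {S : Finset Vertex} (h : ((S : Set Vertex) ∩ A).Nonempty) (m : ℕ) :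
    meanTime q A m S = 0 := by
  cases m <;> simp [meanTime, h]

lemma meets_insert {S : Finset Vertex} (h : ((S : Set Vertex) ∩ A).Nonempty) (v : Vertex) :
    (((insert v S : Finset Vertex) : Set Vertex) ∩ A).Nonempty := by
  refine h.mono ?_
  gcongr
  simp

lemma meanTime_nonneg (hq : IsGrowthRate q) (hc : 0 < c) (hb : RatesBounded q c C)
    (m : ℕ) (S : Finset Vertex) : 0 ≤ meanTime q A m S := by
  induction m generalizing S with
  | zero => simp [meanTime]
  | succ m ih =>
    rw [meanTime]
    split_ifs
    · exact le_rfl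
    · have hq0 : ∀ v ∈ boundary S, 0 ≤ q S (insert v S) := fun v hv =>
        hc.le.trans (hb S v (mem_boundary.1 hv)).1
      refine div_nonneg (add_nonneg zero_le_one
        (Finset.sum_nonneg fun v hv => mul_nonneg (hq0 v hv) (ih _))) ?_
      rw [exitRate_eq hq]
      exact Finset.sum_nonneg hq0

/-- The rate at which the mean remaining time decreases is `1`. -/
lemma sum_meanTime_sub (hq : IsGrowthRate q) (hc : 0 < c) (hb : RatesBounded q c C)
    {S : Finset Vertex} (hS : S.Nonempty) (hSA : ¬ ((S : Set Vertex) ∩ A).Nonempty) (m : ℕ) :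
    ∑ v ∈ boundary S, q S (insert v S) * (meanTime q A (m + 1) S - meanTime q A m (insert v S))
      = 1 := by
  have hpos := exitRate_pos hq hc hb hS
  simp only [mul_sub, Finset.sum_sub_distrib, ← Finset.sum_mul, ← exitRate_eq hq]
  rw [meanTime, if_neg hSA]
  field_simp
  ring

/-- A maximum-principle argument, by induction on the truncation. Compare the unit-decrease
identities at S and at S ∪ {w}: the latter has larger rates and more boundary vertices apart from w,
and its terms are nonnegative by induction. This forces the drop D from S to S ∪ {w} to satisfy 0 ≤
`exitRate q S` * D. -/
lemma meanTime_insert_le (hq : IsGrowthRate q) (hc : 0 < c) (hb : RatesBounded q c C)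
    (hmono : RatesMonotone q) (m : ℕ) {S : Finset Vertex} {w : Vertex} (hw : AdjTo w S) :
    meanTime q A m (insert w S) ≤ meanTime q A (m + 1) S := by
  induction m generalizing S w with
  | zero => exact meanTime_nonneg hq hc hb 1 S
  | succ m ih =>
    have hS : S.Nonempty := ⟨_, hw.2.choose_spec.1⟩
    by_cases hSw : (((insert w S : Finset Vertex) : Set Vertex) ∩ A).Nonempty
    · rw [meanTime_of_meets hSw]
      exact meanTime_nonneg hq hc hb _ S
    have hSA : ¬ ((S : Set Vertex) ∩ A).Nonempty := fun h => hSw (meets_insert h w)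
    have e1 := sum_meanTime_sub hq hc hb hS hSA (m + 1)
    have e2 := sum_meanTime_sub hq hc hb (Finset.insert_nonempty w S) hSw m
    have hwb := mem_boundary.2 hw
    have hpos := exitRate_pos hq hc hb hS
    have hexit := exitRate_eq hq S
    -- The term of `w` is split off because `w` is no longer a boundary vertex of `insert w S`.
    rw [← Finset.add_sum_erase _ _ hwb] at e1 hexit
    have hle : ∑ v ∈ (boundary S).erase w, q S (insert v S) *
        (meanTime q A (m + 1) (insert w S) - meanTime q A m (insert v (insert w S))) ≤ 1 := by
      rw [← e2]
      have hadj : ∀ v ∈ (boundary S).erase w, v ≠ w ∧ AdjTo v S := fun v hv =>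
        ⟨Finset.ne_of_mem_erase hv, mem_boundary.1 (Finset.mem_of_mem_erase hv)⟩
      have hnn : ∀ v, AdjTo v (insert w S) → 0 ≤
          meanTime q A (m + 1) (insert w S) - meanTime q A m (insert v (insert w S)) :=
        fun v hv => sub_nonneg.2 (ih hv)
      refine (Finset.sum_le_sum fun v hv => mul_le_mul_of_nonneg_right
        (hmono S v w (hadj v hv).2 hw (hadj v hv).1) (hnn v ((hadj v hv).2.insert (hadj v hv).1))).trans
        (Finset.sum_le_sum_of_subset_of_nonneg ?_ ?_)
      · exact fun v hv => mem_boundary.2 ((hadj v hv).2.insert (hadj v hv).1)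
      · exact fun v hv _ => mul_nonneg (hc.le.trans (hb _ v (mem_boundary.1 hv)).1)
          (hnn v (mem_boundary.1 hv))
    -- Both orders of adding `v` and `w` lead to the same set, so the induction hypothesis at
    -- `insert v S` bounds the value at `insert v (insert w S)`. The last summand carries the drop
    -- D, with no dependence on `v` beyond the rate.
    have hterm : ∑ v ∈ (boundary S).erase w, q S (insert v S) *
          (meanTime q A (m + 2) S - meanTime q A (m + 1) (insert v S)) ≤
        ∑ v ∈ (boundary S).erase w, (q S (insert v S) *
          (meanTime q A (m + 1) (insert w S) - meanTime q A m (insert v (insert w S))) +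
          q S (insert v S) * (meanTime q A (m + 2) S - meanTime q A (m + 1) (insert w S))) := by
      refine Finset.sum_le_sum fun v hv => ?_
      have hvS := mem_boundary.1 (Finset.mem_of_mem_erase hv)
      have hvw := Finset.ne_of_mem_erase hv
      have := ih (hw.insert hvw.symm)
      rw [Finset.insert_comm] at this
      rw [← mul_add]
      refine mul_le_mul_of_nonneg_left ?_ (hc.le.trans (hb S v hvS).1)
      linarith
    rw [Finset.sum_add_distrib, ← Finset.sum_mul] at hterm
    have hD : 0 ≤ exitRate q S *
        (meanTime q A (m + 2) S - meanTime q A (m + 1) (insert w S)) := by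
      rw [hexit, add_mul]
      linarith
    exact sub_nonneg.1 (nonneg_of_mul_nonneg_right hD hpos)

/-- One term of a sum of nonnegative terms equal to 1 is at most 1, and its rate is at least `c`. -/
lemma meanTime_sub_le (hq : IsGrowthRate q) (hc : 0 < c) (hb : RatesBounded q c C)
    (hmono : RatesMonotone q) (m : ℕ) {S : Finset Vertex} {w : Vertex} (hw : AdjTo w S) :
    meanTime q A (m + 1) S - meanTime q A m (insert w S) ≤ 1 / c := by
  by_cases hSA : ((S : Set Vertex) ∩ A).Nonempty
  · rw [meanTime_of_meets hSA, meanTime_of_meets (meets_insert hSA w), sub_zero]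
    positivity
  · have hS : S.Nonempty := ⟨_, hw.2.choose_spec.1⟩
    have hnn := fun v (hv : v ∈ boundary S) =>
      sub_nonneg.2 (meanTime_insert_le (A := A) hq hc hb hmono m (mem_boundary.1 hv))
    have h1 := Finset.single_le_sum (fun v hv => mul_nonneg
      (hc.le.trans (hb S v (mem_boundary.1 hv)).1) (hnn v hv)) (mem_boundary.2 hw)
    rw [sum_meanTime_sub hq hc hb hS hSA m] at h1
    rw [le_div_iff₀ hc]
    have := mul_le_mul_of_nonneg_right (hb S w hw).1 (hnn w (mem_boundary.2 hw))
    linarith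

/-- Follow a shortest lattice path from `u` to `a`: adding its next vertex costs at most `1 / c`.
The bound does not depend on the truncation. -/
lemma meanTime_le (hq : IsGrowthRate q) (hc : 0 < c) (hb : RatesBounded q c C)
    (hmono : RatesMonotone q) {a : Vertex} (ha : a ∈ A) (k m : ℕ) {S : Finset Vertex} {u : Vertex}
    (hu : u ∈ S) (hk : |u.1 - a.1| + |u.2 - a.2| = k) : meanTime q A m S ≤ k / c := by
  induction k generalizing m S u with
  | zero =>
    have hua : u = a := by
      ext <;> rcases abs_cases (u.1 - a.1) with h | h <;>
        rcases abs_cases (u.2 - a.2) with h' | h' <;> push_cast at hk <;> omega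
    rw [meanTime_of_meets ⟨u, hu, hua ▸ ha⟩]
    simp
  | succ k ih =>
    obtain ⟨u', hadj, hk'⟩ : ∃ u', LatticeAdj u u' ∧ |u'.1 - a.1| + |u'.2 - a.2| = k := by
      simp only [latticeAdj_iff]
      push_cast at hk
      -- A nonzero coordinate of `u - a` can be moved one unit closer to 0.
      have key : ∀ x : ℤ, |x + 1| = |x| - 1 ∨ |x - 1| = |x| - 1 ∨ |x| = 0 := by
        intro x
        rcases abs_cases x with h | h <;> rcases abs_cases (x + 1) with h' | h' <;>
          rcases abs_cases (x - 1) with h'' | h'' <;> omega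
      have hx := key (u.1 - a.1)
      have hy := key (u.2 - a.2)
      rw [sub_add_eq_add_sub, sub_right_comm] at hx hy
      rcases hx with h | h | h
      · exact ⟨_, Or.inl rfl, by simp only; omega⟩
      · exact ⟨_, Or.inr (Or.inl rfl), by simp only; omega⟩
      · rcases hy with h' | h' | h'
        · exact ⟨_, Or.inr (Or.inr (Or.inl rfl)), by simp only; omega⟩
        · exact ⟨_, Or.inr (Or.inr (Or.inr rfl)), by simp only; omega⟩
        · omega
    have hstep : (k : ℝ) / c + 1 / c = ((k + 1 : ℕ) : ℝ) / c := by push_cast; ring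
    have h1c : (0 : ℝ) ≤ 1 / c := by positivity
    -- If the next path vertex is already present, the set and the truncation stay as they are and
    -- only the distance decreases.
    by_cases hu' : u' ∈ S
    · have := ih m hu' hk'
      linarith
    · cases m with
      | zero => simp only [meanTime]; positivity
      | succ m =>
        have h1 := ih m (Finset.mem_insert_self u' S) hk'
        have h2 := meanTime_sub_le (A := A) hq hc hb hmono m (w := u') ⟨hu', u, hu, hadj⟩
        linarith

end Rates

/-! ### Moments of the exponential law -/

/-- The exponential distribution, as a measure on `[0, ∞]`. -/
noncomputable def expLaw (r : ℝ) : Measure ℝ≥0∞ := (expMeasure r).map ENNReal.ofReal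

lemma isProbabilityMeasure_expLaw {r : ℝ} (hr : 0 < r) : IsProbabilityMeasure (expLaw r) :=
  have := isProbabilityMeasure_expMeasure hr
  Measure.isProbabilityMeasure_map (by fun_prop)

lemma expLaw_Ioi {r : ℝ} (hr : 0 < r) (t : ℝ≥0) :
    expLaw r (Set.Ioi (t : ℝ≥0∞)) = ENNReal.ofReal (Real.exp (-(r * t))) := by
  have := isProbabilityMeasure_expMeasure hr
  have hpre : ENNReal.ofReal ⁻¹' Set.Ioi (t : ℝ≥0∞) = (Set.Iic (t : ℝ))ᶜ := by
    ext x
    simp only [Set.mem_preimage, Set.mem_Ioi, Set.compl_Iic]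
    rw [ENNReal.lt_ofReal_iff_toReal_lt ENNReal.coe_ne_top, ENNReal.coe_toReal]
  rw [expLaw, Measure.map_apply (by fun_prop) measurableSet_Ioi, hpre,
    prob_compl_eq_one_sub measurableSet_Iic, ← ofReal_cdf, cdf_expMeasure_eq hr,
    if_pos t.coe_nonneg, ← ENNReal.ofReal_one, ← ENNReal.ofReal_sub]
  · congr 1; ring
  · exact sub_nonneg.2 (Real.exp_le_one_iff.2 (neg_nonpos.2 (by positivity)))

lemma lintegral_expLaw {r : ℝ} {g : ℝ≥0∞ → ℝ≥0∞} (hg : Measurable g) :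
    ∫⁻ s, g s ∂(expLaw r) = ∫⁻ x, gammaPDF 1 r x * g (ENNReal.ofReal x) := by
  rw [expLaw, lintegral_map hg (by fun_prop), expMeasure, gammaMeasure,
    lintegral_withDensity_eq_lintegral_mul _ (by unfold gammaPDF; fun_prop) (by fun_prop)]
  rfl

/-- Weighting the exponential density by xⁿ gives a multiple of the Gamma(n + 1) density, so every
moment reduces to a total mass of 1. -/
lemma gammaPDF_one_mul_pow {r : ℝ} (hr : 0 < r) (n : ℕ) (x : ℝ) :
    gammaPDF 1 r x * ENNReal.ofReal x ^ n =
      ENNReal.ofReal (n.factorial / r ^ n) * gammaPDF (n + 1) r x := by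
  rcases lt_or_ge x 0 with hx | hx
  · simp [gammaPDF_of_neg hx]
  · rw [gammaPDF_of_nonneg hx, gammaPDF_of_nonneg hx, ← ENNReal.ofReal_pow hx,
      ← ENNReal.ofReal_mul (by positivity), ← ENNReal.ofReal_mul (by positivity)]
    congr 1
    have : (n.factorial : ℝ) ≠ 0 := by positivity
    rw [Real.Gamma_nat_eq_factorial, Real.Gamma_one, add_sub_cancel_right, sub_self, Real.rpow_zero,
      Real.rpow_one, Real.rpow_natCast, ← Nat.cast_add_one, Real.rpow_natCast, pow_succ]
    field_simp

lemma lintegral_pow_expLaw {r : ℝ} (hr : 0 < r) (n : ℕ) :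
    ∫⁻ s, s ^ n ∂(expLaw r) = ENNReal.ofReal (n.factorial / r ^ n) := by
  rw [lintegral_expLaw (by fun_prop)]
  simp_rw [gammaPDF_one_mul_pow hr]
  rw [lintegral_const_mul _ (by unfold gammaPDF; fun_prop),
    lintegral_gammaPDF_eq_one (by positivity) hr, mul_one]

lemma lintegral_add_expLaw {r h : ℝ} (hr : 0 < r) (hh : 0 ≤ h) :
    ∫⁻ s, (s + ENNReal.ofReal h) ∂(expLaw r) = ENNReal.ofReal (1 / r + h) := by
  have := isProbabilityMeasure_expLaw hr
  have h1 := lintegral_pow_expLaw hr 1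
  simp only [pow_one, Nat.factorial_one, Nat.cast_one] at h1
  rw [lintegral_add_right _ measurable_const, h1, lintegral_const, measure_univ, mul_one,
    ENNReal.ofReal_add (by positivity) hh]

lemma lintegral_add_sq_expLaw {r h : ℝ} (hr : 0 < r) (hh : 0 ≤ h) :
    ∫⁻ s, (s + ENNReal.ofReal h) ^ 2 ∂(expLaw r) =
      ENNReal.ofReal (2 / r ^ 2 + 2 * h / r + h ^ 2) := by
  have := isProbabilityMeasure_expLaw hr
  have h1 := lintegral_pow_expLaw hr 1
  have h2 := lintegral_pow_expLaw hr 2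
  simp only [pow_one, Nat.factorial_one, Nat.cast_one] at h1
  simp only [Nat.factorial_two, Nat.cast_ofNat] at h2
  have hexp : ∀ s : ℝ≥0∞, (s + ENNReal.ofReal h) ^ 2 =
      s ^ 2 + ENNReal.ofReal (2 * h) * s + ENNReal.ofReal (h ^ 2) := by
    intro s
    rw [ENNReal.ofReal_mul zero_le_two, ENNReal.ofReal_pow hh, ENNReal.ofReal_ofNat]
    ring
  simp_rw [hexp]
  rw [lintegral_add_right _ measurable_const, lintegral_add_right _ (by fun_prop),
    lintegral_const_mul _ measurable_id', h1, h2, lintegral_const, measure_univ, mul_one,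
    ← ENNReal.ofReal_mul (by positivity), ← ENNReal.ofReal_add (by positivity) (by positivity),
    ← ENNReal.ofReal_add (by positivity) (by positivity), mul_one_div]

/-! ### One step of the chain given its history -/

section Chain

variable {E Ω : Type*} {mΩ : MeasurableSpace Ω} {P : Measure Ω}
  {q : E → E → ℝ} {x₀ : E} {Y : ℕ → Ω → E} {τ : ℕ → Ω → ℝ≥0∞}

lemma IsJumpHolding.history_le (h : IsJumpHolding P q x₀ Y τ) (n : ℕ) : history Y τ n ≤ mΩ :=
  sup_le (iSup₂_le fun k _ => (h.measurable_state k).comap_le)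
    (iSup₂_le fun k _ => (h.measurable_hold k).comap_le)

lemma measurable_state_history {k n : ℕ} (hkn : k ≤ n) : Measurable[history Y τ n, ⊤] (Y k) :=
  Measurable.of_comap_le (le_sup_of_le_left
    (le_iSup₂_of_le (f := fun k (_ : k ∈ Set.Iic n) => MeasurableSpace.comap (Y k) ⊤)
      k hkn le_rfl))

lemma measurable_hold_history {k n : ℕ} (hkn : k < n) : Measurable[history Y τ n] (τ k) :=
  Measurable.of_comap_le (le_sup_of_le_right
    (le_iSup₂_of_le (f := fun k (_ : k ∈ Set.Iio n) => MeasurableSpace.comap (τ k) inferInstance)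
      k hkn le_rfl))

lemma IsJumpHolding.measurableSet_state (h : IsJumpHolding P q x₀ Y τ) (n : ℕ) (x : E) :
    MeasurableSet {ω | Y n ω = x} :=
  h.measurable_state n (show MeasurableSet[⊤] {x} from trivial)

lemma IsJumpHolding.measurable_comp_state {M : Type*} [MeasurableSpace M]
    (h : IsJumpHolding P q x₀ Y τ) (n : ℕ) (F : E → M) : Measurable fun ω => F (Y n ω) :=
  (measurable_from_top (f := F)).comp (h.measurable_state n)

lemma IsJumpHolding.lintegral_eq_tsum_state [Countable E] (h : IsJumpHolding P q x₀ Y τ) (n : ℕ)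
    {s : Set Ω} (hs : MeasurableSet s) (F : Ω → ℝ≥0∞) :
    ∫⁻ ω in s, F ω ∂P = ∑' x, ∫⁻ ω in s ∩ {ω | Y n ω = x}, F ω ∂P := by
  rw [← lintegral_iUnion (fun x => hs.inter (h.measurableSet_state n x)), ← Set.inter_iUnion]
  · congr 2
    ext ω
    simp
  · intro x y hxy
    refine Set.disjoint_left.2 fun ω hx hy => hxy ?_
    exact hx.2.symm.trans hy.2

lemma IsJumpHolding.measure_eq_tsum_state [Countable E] (h : IsJumpHolding P q x₀ Y τ) (n : ℕ)
    {s : Set Ω} (hs : MeasurableSet s) :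
    P s = ∑' x, P (s ∩ {ω | Y n ω = x}) := by
  simpa using h.lintegral_eq_tsum_state n hs fun _ => 1

variable [IsProbabilityMeasure P] [Countable E]

/-- Summing the step property at `t = 0` over the next state shows that {Y n = x, τ n > 0} has the
full mass of {Y n = x}. -/
lemma IsJumpHolding.measure_hold_eq_zero (h : IsJumpHolding P q x₀ Y τ) (n : ℕ) {x : E}
    (hx : ∑' y, ENNReal.ofReal (jumpProb q x y) = 1) :
    P {ω | Y n ω = x ∧ τ n ω = 0} = 0 := by
  have hm := h.measurableSet_state n x
  have hτ : MeasurableSet {ω | 0 < τ n ω} := measurableSet_lt measurable_const (h.measurable_hold n)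
  have h1 : P ({ω | Y n ω = x} ∩ {ω | 0 < τ n ω}) = P {ω | Y n ω = x} := by
    rw [h.measure_eq_tsum_state (n + 1) (hm.inter hτ)]
    have := fun y => h.step n Set.univ MeasurableSet.univ x y 0
    simp only [Set.univ_inter, NNReal.coe_zero, mul_zero, neg_zero, Real.exp_zero, mul_one,
      ENNReal.coe_zero] at this
    rw [← mul_one (P {ω | Y n ω = x}), ← hx, ← ENNReal.tsum_mul_left]
    refine tsum_congr fun y => ?_
    rw [← this y]
    congr 1
    ext ω
    simp only [Set.mem_inter_iff, Set.mem_ofPred_eq]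
    tauto
  have h2 := measure_inter_add_sdiff (μ := P) {ω | Y n ω = x} hτ
  rw [h1] at h2
  have h3 := (ENNReal.add_right_inj (measure_ne_top P _)).1 (h2.trans (add_zero _).symm)
  convert! h3 using 2
  ext ω
  simp

lemma IsJumpHolding.measure_inter_jump (h : IsJumpHolding P q x₀ Y τ) (n : ℕ) {x : E} (y : E)
    (hx : ∑' y, ENNReal.ofReal (jumpProb q x y) = 1) {H : Set Ω}
    (hH : MeasurableSet[history Y τ n] H) :
    P (H ∩ {ω | Y n ω = x ∧ Y (n + 1) ω = y}) =
      P (H ∩ {ω | Y n ω = x}) * ENNReal.ofReal (jumpProb q x y) := by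
  have := h.step n H hH x y 0
  simp only [NNReal.coe_zero, mul_zero, neg_zero, Real.exp_zero, mul_one, ENNReal.coe_zero] at this
  rw [← this]
  refine measure_congr ?_
  have h0 : ∀ᵐ ω ∂P, ¬ (Y n ω = x ∧ τ n ω = 0) := by
    rw [ae_iff]; simpa using h.measure_hold_eq_zero n hx
  filter_upwards [h0] with ω hω
  apply propext
  change (ω ∈ H ∧ _ ∧ _) ↔ (ω ∈ H ∧ _ ∧ _ ∧ _)
  simp only [pos_iff_ne_zero]
  tauto

/-- Given the history, the holding time and the next state are independent, with an exponential
holding time. -/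
lemma IsJumpHolding.map_hold (h : IsJumpHolding P q x₀ Y τ) (n : ℕ) {x : E} (y : E)
    (hr : 0 < exitRate q x) (hp : 0 ≤ jumpProb q x y)
    (hx : ∑' y, ENNReal.ofReal (jumpProb q x y) = 1) {H : Set Ω}
    (hH : MeasurableSet[history Y τ n] H) :
    (P.restrict (H ∩ {ω | Y n ω = x ∧ Y (n + 1) ω = y})).map (τ n) =
      (P (H ∩ {ω | Y n ω = x}) * ENNReal.ofReal (jumpProb q x y)) • expLaw (exitRate q x) := by
  have := isProbabilityMeasure_expLaw hr
  set κ := P (H ∩ {ω | Y n ω = x}) * ENNReal.ofReal (jumpProb q x y) with hκ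
  have huniv : (P.restrict (H ∩ {ω | Y n ω = x ∧ Y (n + 1) ω = y})).map (τ n) Set.univ =
      (κ • expLaw (exitRate q x)) Set.univ := by
    rw [Measure.map_apply (h.measurable_hold n) MeasurableSet.univ, Set.preimage_univ,
      Measure.restrict_apply_univ, h.measure_inter_jump n y hx hH]
    simp [hκ]
  have hfin : IsFiniteMeasure
      ((P.restrict (H ∩ {ω | Y n ω = x ∧ Y (n + 1) ω = y})).map (τ n)) := inferInstance
  -- The step property gives the tails, and the half-lines (t, ∞] form a π-system. They do not
  -- include the whole space, since 0 is missing; the total mass is therefore the separate fact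
  -- `huniv`.
  refine ext_of_generate_finite _ (borel_eq_generateFrom_Ioi ℝ≥0∞ ▸ BorelSpace.measurable_eq)
    isPiSystem_Ioi ?_ huniv
  rintro _ ⟨t, rfl⟩
  by_cases ht : t = ∞
  · simp [ht]
  lift t to ℝ≥0 using ht
  rw [Measure.map_apply (h.measurable_hold n) measurableSet_Ioi,
    Measure.restrict_apply (h.measurable_hold n measurableSet_Ioi), Measure.smul_apply,
    expLaw_Ioi hr, smul_eq_mul, hκ, mul_assoc, ← ENNReal.ofReal_mul hp, ← h.step n H hH x y t]
  congr 1
  ext ω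
  simp only [Set.mem_inter_iff, Set.mem_preimage, Set.mem_Ioi, Set.mem_ofPred_eq]
  tauto

lemma IsJumpHolding.setLIntegral_mul_hold (h : IsJumpHolding P q x₀ Y τ) (n : ℕ) {x : E} (y : E)
    (hr : 0 < exitRate q x) (hp : 0 ≤ jumpProb q x y)
    (hx : ∑' y, ENNReal.ofReal (jumpProb q x y) = 1) {f : Ω → ℝ≥0∞}
    (hf : Measurable[history Y τ n] f) {g : ℝ≥0∞ → ℝ≥0∞} (hg : Measurable g) :
    ∫⁻ ω in {ω | Y n ω = x ∧ Y (n + 1) ω = y}, f ω * g (τ n ω) ∂P =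
      (∫⁻ ω in {ω | Y n ω = x}, f ω ∂P) *
        (ENNReal.ofReal (jumpProb q x y) * ∫⁻ s, g s ∂(expLaw (exitRate q x))) := by
  have hle := h.history_le n
  have hgτ : Measurable fun ω => g (τ n ω) := hg.comp (h.measurable_hold n)
  refine Measurable.ennreal_induction (mα := history Y τ n) ?_ ?_ ?_ hf
  · intro a H hH
    have e1 : ∀ ω, H.indicator (fun _ => a) ω * g (τ n ω) =
        H.indicator (fun ω => a * g (τ n ω)) ω := fun ω => by
      by_cases hω : ω ∈ H <;> simp [hω]
    simp_rw [e1]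
    rw [lintegral_indicator (hle _ hH), lintegral_indicator (hle _ hH),
      Measure.restrict_restrict (hle _ hH), Measure.restrict_restrict (hle _ hH),
      lintegral_const_mul _ hgτ, ← lintegral_map hg (h.measurable_hold n),
      h.map_hold n y hr hp hx hH, lintegral_smul_measure, setLIntegral_const, smul_eq_mul]
    ring
  · intro f₁ f₂ _ hf₁ hf₂ h₁ h₂
    simp only [Pi.add_apply, add_mul]
    have hm : Measurable fun ω => f₁ ω * g (τ n ω) := (hf₁.mono hle le_rfl).mul hgτ
    rw [lintegral_add_left hm, h₁, h₂,
      lintegral_add_left (hf₁.mono hle le_rfl), add_mul]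
  · intro f hf hmono hind
    simp only [ENNReal.iSup_mul]
    have hm : ∀ k, Measurable fun ω => f k ω * g (τ n ω) := fun k =>
      ((hf k).mono hle le_rfl).mul hgτ
    rw [lintegral_iSup hm fun i j hij ω => mul_le_mul_left (hmono hij ω) _,
      lintegral_iSup (fun k => (hf k).mono hle le_rfl) hmono, ENNReal.iSup_mul]
    exact iSup_congr hind

/-- The working form of the Markov property: a weight `f` from the past factors out of the mean of
any function of the next state and the current holding time. -/
lemma IsJumpHolding.setLIntegral_mul_jump (h : IsJumpHolding P q x₀ Y τ) (n : ℕ) {x : E}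
    (hr : 0 < exitRate q x) (hp : ∀ y, 0 ≤ jumpProb q x y)
    (hx : ∑' y, ENNReal.ofReal (jumpProb q x y) = 1) {f : Ω → ℝ≥0∞}
    (hf : Measurable[history Y τ n] f) {G : E → ℝ≥0∞ → ℝ≥0∞} (hG : ∀ y, Measurable (G y)) :
    ∫⁻ ω in {ω | Y n ω = x}, f ω * G (Y (n + 1) ω) (τ n ω) ∂P =
      (∫⁻ ω in {ω | Y n ω = x}, f ω ∂P) *
        ∑' y, ENNReal.ofReal (jumpProb q x y) * ∫⁻ s, G y s ∂(expLaw (exitRate q x)) := by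
  rw [h.lintegral_eq_tsum_state (n + 1) (h.measurableSet_state n x), ← ENNReal.tsum_mul_left]
  refine tsum_congr fun y => ?_
  rw [← h.setLIntegral_mul_hold n y hr (hp y) hx hf (hG y)]
  refine setLIntegral_congr_fun ((h.measurableSet_state n x).inter
    (h.measurableSet_state (n + 1) y)) fun ω hω => ?_
  have : Y (n + 1) ω = y := hω.2
  simp only [this]

end Chain

/-! ### Mean and second moment of a martingale increment -/

section Moments

variable {q : Finset Vertex → Finset Vertex → ℝ} {c C : ℝ} {A : Set Vertex}

lemma sum_jumpProb_meanTime_sub (hq : IsGrowthRate q) (hc : 0 < c) (hb : RatesBounded q c C)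
    {S : Finset Vertex} (hS : S.Nonempty) (hSA : ¬ ((S : Set Vertex) ∩ A).Nonempty) (m : ℕ) :
    ∑ v ∈ boundary S, jumpProb q S (insert v S) *
      (meanTime q A (m + 1) S - meanTime q A m (insert v S)) = 1 / exitRate q S := by
  have hpos := exitRate_pos hq hc hb hS
  rw [← sum_meanTime_sub hq hc hb hS hSA m, Finset.sum_div]
  refine Finset.sum_congr rfl fun v hv => ?_
  rw [jumpProb_insert (mem_boundary.1 hv) hpos.ne', div_mul_eq_mul_div]

lemma sum_jumpProb_mean (hq : IsGrowthRate q) (hc : 0 < c) (hb : RatesBounded q c C)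
    {S : Finset Vertex} (hS : S.Nonempty) (hSA : ¬ ((S : Set Vertex) ∩ A).Nonempty) (m : ℕ) :
    ∑ v ∈ boundary S, jumpProb q S (insert v S) *
      (1 / exitRate q S + meanTime q A m (insert v S)) = meanTime q A (m + 1) S := by
  have h1 := sum_jumpProb_meanTime_sub hq hc hb hS hSA m
  have h2 := sum_jumpProb hq hc hb hS
  simp only [mul_sub, mul_add, Finset.sum_sub_distrib, Finset.sum_add_distrib, ← Finset.sum_mul,
    h2, one_mul] at h1 ⊢
  linarith

/-- With l the exit rate and b the mean time at S, the left side is the mean of (τ + h')², where τ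
is exponential and h' is the value after the jump. The variance 1/l² of τ cancels exactly against
(E(b - h'))² = 1/l², leaving b² + E(b - h')². Finally 0 ≤ b - h' ≤ 1/c and E(b - h') = 1/l bound the
last term. -/
lemma sum_jumpProb_second_moment_le (hq : IsGrowthRate q) (hc : 0 < c) (hb : RatesBounded q c C)
    (hmono : RatesMonotone q)
    {S : Finset Vertex} (hS : S.Nonempty) (hSA : ¬ ((S : Set Vertex) ∩ A).Nonempty) (m : ℕ) :
    ∑ v ∈ boundary S, jumpProb q S (insert v S) *
      (2 / exitRate q S ^ 2 + 2 * meanTime q A m (insert v S) / exitRate q S +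
        meanTime q A m (insert v S) ^ 2) ≤
      meanTime q A (m + 1) S ^ 2 + 1 / c * (1 / exitRate q S) := by
  have h1 := sum_jumpProb_meanTime_sub hq hc hb hS hSA m
  have h2 := sum_jumpProb hq hc hb hS
  have hpos := exitRate_pos hq hc hb hS
  set l := exitRate q S with hl
  set b := meanTime q A (m + 1) S with hb'
  have h3 : ∑ v ∈ boundary S, jumpProb q S (insert v S) * (b - meanTime q A m (insert v S)) ^ 2 ≤
      1 / c * (1 / l) := by
    rw [← h1, Finset.mul_sum]
    refine Finset.sum_le_sum fun v hv => ?_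
    have hv' := mem_boundary.1 hv
    have e1 := sub_nonneg.2 (meanTime_insert_le (A := A) hq hc hb hmono m hv')
    have e2 := meanTime_sub_le (A := A) hq hc hb hmono m hv'
    have e3 := jumpProb_nonneg hq hc hb hS (insert v S)
    rw [mul_left_comm, pow_two]
    exact mul_le_mul_of_nonneg_left (mul_le_mul_of_nonneg_right e2 e1) e3
  -- Expansion in powers of b - h'; the linear term is then evaluated by `h1`.
  have h4 : ∀ v, jumpProb q S (insert v S) * (2 / l ^ 2 + 2 * meanTime q A m (insert v S) / l +
        meanTime q A m (insert v S) ^ 2) =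
      jumpProb q S (insert v S) * (2 / l ^ 2 + 2 * b / l + b ^ 2)
      - jumpProb q S (insert v S) * (b - meanTime q A m (insert v S)) * (2 / l + 2 * b)
      + jumpProb q S (insert v S) * (b - meanTime q A m (insert v S)) ^ 2 := fun v => by
    ring
  simp only [h4, Finset.sum_add_distrib, Finset.sum_sub_distrib, ← Finset.sum_mul, h1, h2]
  have h5 : 1 * (2 / l ^ 2 + 2 * b / l + b ^ 2) - 1 / l * (2 / l + 2 * b) = b ^ 2 := by
    field_simp
    ring
  linarith

end Moments

/-! ### The martingale along the jump chain -/

section ActiveTime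

variable {Ω : Type*}

open Classical in
/-- The holding time in the `n`-th state if that state does not meet `A`, and `0` otherwise. -/
noncomputable def activeHold (Y : ℕ → Ω → Finset Vertex) (τ : ℕ → Ω → ℝ≥0∞) (A : Set Vertex)
    (n : ℕ) (ω : Ω) : ℝ≥0∞ :=
  if ((Y n ω : Set Vertex) ∩ A).Nonempty then 0 else τ n ω

/-- The time spent in the first `n` states before meeting `A`. -/
noncomputable def activeTime (Y : ℕ → Ω → Finset Vertex) (τ : ℕ → Ω → ℝ≥0∞) (A : Set Vertex)
    (n : ℕ) (ω : Ω) : ℝ≥0∞ :=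
  ∑ k ∈ Finset.range n, activeHold Y τ A k ω

variable {mΩ : MeasurableSpace Ω} {P : Measure Ω}
  {q : Finset Vertex → Finset Vertex → ℝ} {c C : ℝ} {A : Set Vertex} {x₀ : Finset Vertex}
  {Y : ℕ → Ω → Finset Vertex} {τ : ℕ → Ω → ℝ≥0∞}

lemma measurable_activeHold_history {k n : ℕ} (hkn : k < n) :
    Measurable[history Y τ n] (activeHold Y τ A k) := by
  classical
  refine Measurable.ite ?_ measurable_const (measurable_hold_history hkn)
  exact measurable_state_history hkn.le
    (show MeasurableSet[⊤] {S : Finset Vertex | ((S : Set Vertex) ∩ A).Nonempty} from trivial)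

lemma measurable_activeTime_history (n : ℕ) :
    Measurable[history Y τ n] (activeTime Y τ A n) :=
  Finset.measurable_fun_sum _ fun _ hk => measurable_activeHold_history (Finset.mem_range.1 hk)

lemma IsJumpHolding.measurable_activeHold (h : IsJumpHolding P q x₀ Y τ) (n : ℕ) :
    Measurable (activeHold Y τ A n) :=
  (measurable_activeHold_history n.lt_succ_self).mono (h.history_le _) le_rfl

lemma IsJumpHolding.measurable_activeTime (h : IsJumpHolding P q x₀ Y τ) (n : ℕ) :
    Measurable (activeTime Y τ A n) :=
  (measurable_activeTime_history n).mono (h.history_le _) le_rfl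

variable [IsProbabilityMeasure P]

lemma IsJumpHolding.ae_jump_of_nonempty (h : IsJumpHolding P q x₀ Y τ) (hq : IsGrowthRate q)
    (hc : 0 < c) (hb : RatesBounded q c C) (n : ℕ) :
    ∀ᵐ ω ∂P, (Y n ω).Nonempty →
      0 < τ n ω ∧ ∃ v, AdjTo v (Y n ω) ∧ Y (n + 1) ω = insert v (Y n ω) := by
  have h1 : ∀ᵐ ω ∂P, ∀ S : Finset Vertex, S.Nonempty → ¬ (Y n ω = S ∧ τ n ω = 0) := by
    refine ae_all_iff.2 fun S => ?_
    by_cases hS : S.Nonempty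
    · have := h.measure_hold_eq_zero n (tsum_jumpProb hq hc hb hS)
      filter_upwards [measure_eq_zero_iff_ae_notMem.1 this] with ω hω _ using hω
    · simp [hS]
  have h2 : ∀ᵐ ω ∂P, ∀ S S' : Finset Vertex, S.Nonempty →
      (¬ ∃ v, AdjTo v S ∧ S' = insert v S) → ¬ (Y n ω = S ∧ Y (n + 1) ω = S') := by
    refine ae_all_iff.2 fun S => ae_all_iff.2 fun S' => ?_
    by_cases hS : S.Nonempty
    · by_cases hv : ∃ v, AdjTo v S ∧ S' = insert v S
      · filter_upwards with ω _ hv' using absurd hv hv'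
      · have := h.measure_inter_jump n S' (tsum_jumpProb hq hc hb hS) MeasurableSet.univ
        rw [jumpProb_eq_zero hq (exitRate_pos hq hc hb hS).ne' hv, ENNReal.ofReal_zero, mul_zero,
          Set.univ_inter] at this
        filter_upwards [measure_eq_zero_iff_ae_notMem.1 this] with ω hω _ _ using hω
    · simp [hS]
  filter_upwards [h1, h2] with ω hω1 hω2 hne
  refine ⟨pos_iff_ne_zero.2 fun h0 => hω1 _ hne ⟨rfl, h0⟩, ?_⟩
  by_contra hv
  exact hω2 _ _ hne hv ⟨rfl, rfl⟩

/-- Each jump adds exactly one vertex, so the cardinality, and through it the exit rate, is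
controlled by the number of jumps. -/
lemma IsJumpHolding.ae_growth (h : IsJumpHolding P q x₀ Y τ) (hx₀ : x₀.Nonempty)
    (hq : IsGrowthRate q) (hc : 0 < c) (hb : RatesBounded q c C) :
    ∀ᵐ ω ∂P, ∀ n, (Y n ω).Nonempty ∧ (Y n ω).card = x₀.card + n ∧
      0 < τ n ω ∧ ∃ v, AdjTo v (Y n ω) ∧ Y (n + 1) ω = insert v (Y n ω) := by
  filter_upwards [h.init, ae_all_iff.2 (h.ae_jump_of_nonempty hq hc hb)] with ω hω0 hω n
  have key : (Y n ω).Nonempty ∧ (Y n ω).card = x₀.card + n := by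
    induction n with
    | zero => rw [hω0]; exact ⟨hx₀, rfl⟩
    | succ n ih =>
      obtain ⟨-, v, hv, hY⟩ := hω n ih.1
      rw [hY, Finset.card_insert_of_notMem hv.1, ih.2]
      exact ⟨Finset.insert_nonempty _ _, rfl⟩
  exact ⟨key.1, key.2, hω n key.1⟩

lemma IsJumpHolding.setLIntegral_hold (h : IsJumpHolding P q x₀ Y τ)
    (hq : IsGrowthRate q) (hc : 0 < c) (hb : RatesBounded q c C) (n : ℕ) {S : Finset Vertex}
    (hS : S.Nonempty) :
    ∫⁻ ω in {ω | Y n ω = S}, τ n ω ∂P = P {ω | Y n ω = S} * ENNReal.ofReal (1 / exitRate q S) := by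
  have hr := exitRate_pos hq hc hb hS
  have := h.setLIntegral_mul_jump n hr (jumpProb_nonneg hq hc hb hS) (tsum_jumpProb hq hc hb hS)
    (f := fun _ => 1) measurable_const (G := fun _ s => s) fun _ => measurable_id
  have h1 := lintegral_add_expLaw hr le_rfl
  simp only [ENNReal.ofReal_zero, add_zero] at h1
  simpa [h1, ENNReal.tsum_mul_right, tsum_jumpProb hq hc hb hS] using this

lemma IsJumpHolding.setLIntegral_step (h : IsJumpHolding P q x₀ Y τ)
    (hq : IsGrowthRate q) (hc : 0 < c) (hb : RatesBounded q c C) (n m : ℕ) {S : Finset Vertex}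
    (hS : S.Nonempty) (hSA : ¬ ((S : Set Vertex) ∩ A).Nonempty)
    {f : Ω → ℝ≥0∞} (hf : Measurable[history Y τ n] f) :
    ∫⁻ ω in {ω | Y n ω = S}, f ω * (τ n ω + ENNReal.ofReal (meanTime q A m (Y (n + 1) ω))) ∂P =
      (∫⁻ ω in {ω | Y n ω = S}, f ω ∂P) * ENNReal.ofReal (meanTime q A (m + 1) S) := by
  have hr := exitRate_pos hq hc hb hS
  have hnn := meanTime_nonneg (A := A) hq hc hb m
  rw [h.setLIntegral_mul_jump n hr (jumpProb_nonneg hq hc hb hS) (tsum_jumpProb hq hc hb hS) hf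
    (G := fun S' s => s + ENNReal.ofReal (meanTime q A m S')) fun _ => by fun_prop]
  simp_rw [lintegral_add_expLaw hr (hnn _)]
  rw [tsum_jumpProb_mul hq hc hb hS fun S' => add_nonneg (by positivity) (hnn S'),
    sum_jumpProb_mean hq hc hb hS hSA]

lemma IsJumpHolding.setLIntegral_step_sq_le (h : IsJumpHolding P q x₀ Y τ)
    (hq : IsGrowthRate q) (hc : 0 < c) (hb : RatesBounded q c C) (hmono : RatesMonotone q)
    (n m : ℕ) {S : Finset Vertex} (hS : S.Nonempty) (hSA : ¬ ((S : Set Vertex) ∩ A).Nonempty) :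
    ∫⁻ ω in {ω | Y n ω = S}, (τ n ω + ENNReal.ofReal (meanTime q A m (Y (n + 1) ω))) ^ 2 ∂P ≤
      P {ω | Y n ω = S} * ENNReal.ofReal (meanTime q A (m + 1) S) ^ 2 +
        ENNReal.ofReal (1 / c) * ∫⁻ ω in {ω | Y n ω = S}, τ n ω ∂P := by
  have hr := exitRate_pos hq hc hb hS
  have hnn := meanTime_nonneg (A := A) hq hc hb
  have := h.setLIntegral_mul_jump n hr (jumpProb_nonneg hq hc hb hS) (tsum_jumpProb hq hc hb hS)
    (f := fun _ => 1) measurable_const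
    (G := fun S' s => (s + ENNReal.ofReal (meanTime q A m S')) ^ 2) fun _ => by fun_prop
  simp_rw [lintegral_add_sq_expLaw hr (hnn m _)] at this
  rw [tsum_jumpProb_mul hq hc hb hS fun S' => by have := hnn m S'; positivity] at this
  simp only [one_mul, lintegral_const, Measure.restrict_apply MeasurableSet.univ,
    Set.univ_inter] at this
  rw [this, h.setLIntegral_hold hq hc hb n hS, mul_left_comm, ← mul_add,
    ← ENNReal.ofReal_pow (hnn _ _), ← ENNReal.ofReal_mul (by positivity),
    ← ENNReal.ofReal_add (by positivity) (by positivity)]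
  gcongr
  exact sum_jumpProb_second_moment_le hq hc hb hmono hS hSA m

lemma activeTime_succ (n : ℕ) (ω : Ω) :
    activeTime Y τ A (n + 1) ω = activeTime Y τ A n ω + activeHold Y τ A n ω :=
  Finset.sum_range_succ _ _

/-- On reaching a state that meets `A`, neither the active time nor the mean remaining time
changes any more. -/
lemma IsJumpHolding.setLIntegral_congr_of_meets (h : IsJumpHolding P q x₀ Y τ) (hx₀ : x₀.Nonempty)
    (hq : IsGrowthRate q) (hc : 0 < c) (hb : RatesBounded q c C) (n m : ℕ) {S : Finset Vertex}
    (hSA : ((S : Set Vertex) ∩ A).Nonempty) (F : ℝ≥0∞ → ℝ≥0∞) :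
    ∫⁻ ω in {ω | Y n ω = S}, F (activeTime Y τ A (n + 1) ω +
        ENNReal.ofReal (meanTime q A m (Y (n + 1) ω))) ∂P =
      ∫⁻ ω in {ω | Y n ω = S}, F (activeTime Y τ A n ω +
        ENNReal.ofReal (meanTime q A (m + 1) (Y n ω))) ∂P := by
  refine setLIntegral_congr_fun_ae (h.measurableSet_state n S) ?_
  filter_upwards [h.ae_growth hx₀ hq hc hb] with ω hω (hS : Y n ω = S)
  obtain ⟨-, -, -, v, -, hY⟩ := hω n
  rw [activeTime_succ, activeHold, if_pos (by rwa [hS]), hY, hS, meanTime_of_meets hSA,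
    meanTime_of_meets (meets_insert hSA v), add_zero]

/-- Each jump moves one state from the remaining budget to the elapsed count, so the two indices
have constant sum. Conditioning on the current state reduces this to `setLIntegral_step`. -/
lemma IsJumpHolding.lintegral_martingale_step (h : IsJumpHolding P q x₀ Y τ) (hx₀ : x₀.Nonempty)
    (hq : IsGrowthRate q) (hc : 0 < c) (hb : RatesBounded q c C) (n m : ℕ) :
    ∫⁻ ω, (activeTime Y τ A (n + 1) ω + ENNReal.ofReal (meanTime q A m (Y (n + 1) ω))) ∂P =
      ∫⁻ ω, (activeTime Y τ A n ω + ENNReal.ofReal (meanTime q A (m + 1) (Y n ω))) ∂P := by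
  rw [← setLIntegral_univ, ← setLIntegral_univ (μ := P)
      fun ω => activeTime Y τ A n ω + ENNReal.ofReal (meanTime q A (m + 1) (Y n ω)),
    h.lintegral_eq_tsum_state n MeasurableSet.univ, h.lintegral_eq_tsum_state n MeasurableSet.univ]
  refine tsum_congr fun S => ?_
  rw [Set.univ_inter]
  by_cases hSA : ((S : Set Vertex) ∩ A).Nonempty
  · exact h.setLIntegral_congr_of_meets hx₀ hq hc hb n m hSA id
  by_cases hS : S.Nonempty
  · have hm := h.measurableSet_state n S
    have e1 := h.setLIntegral_step hq hc hb n m hS hSA (f := fun _ => 1) measurable_const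
    rw [setLIntegral_congr_fun (g := fun ω => activeTime Y τ A n ω +
        (τ n ω + ENNReal.ofReal (meanTime q A m (Y (n + 1) ω)))) hm,
      setLIntegral_congr_fun (f := fun ω => activeTime Y τ A n ω +
        ENNReal.ofReal (meanTime q A (m + 1) (Y n ω))) (g := fun ω => activeTime Y τ A n ω +
        ENNReal.ofReal (meanTime q A (m + 1) S)) hm,
      lintegral_add_left (h.measurable_activeTime n), lintegral_add_left (h.measurable_activeTime n)]
    · simp only [one_mul] at e1
      rw [e1]
      simp [mul_comm]
    · rintro ω (rfl : Y n ω = S)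
      rfl
    · rintro ω (rfl : Y n ω = S)
      simp only [activeTime_succ, activeHold, if_neg hSA, add_assoc]
  · have h0 : P {ω | Y n ω = S} = 0 := by
      refine measure_eq_zero_iff_ae_notMem.2 ?_
      filter_upwards [h.ae_growth hx₀ hq hc hb] with ω hω (hS' : Y n ω = S)
      exact hS (hS' ▸ (hω n).1)
    rw [setLIntegral_measure_zero _ _ h0, setLIntegral_measure_zero _ _ h0]

/-- Square the sum of the past active time and the new part τ + h'. The cross term is exact, by the
first-moment identity with the past as weight; only the square of the new part contributes an
excess, at most 1/c times the mean holding time. -/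
lemma IsJumpHolding.lintegral_martingale_step_sq_le (h : IsJumpHolding P q x₀ Y τ)
    (hx₀ : x₀.Nonempty) (hq : IsGrowthRate q) (hc : 0 < c) (hb : RatesBounded q c C)
    (hmono : RatesMonotone q) (n m : ℕ) :
    ∫⁻ ω, (activeTime Y τ A (n + 1) ω + ENNReal.ofReal (meanTime q A m (Y (n + 1) ω))) ^ 2 ∂P ≤
      ∫⁻ ω, (activeTime Y τ A n ω + ENNReal.ofReal (meanTime q A (m + 1) (Y n ω))) ^ 2 ∂P +
        ENNReal.ofReal (1 / c) * ∫⁻ ω, activeHold Y τ A n ω ∂P := by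
  rw [← setLIntegral_univ, ← setLIntegral_univ (μ := P)
      fun ω => (activeTime Y τ A n ω + ENNReal.ofReal (meanTime q A (m + 1) (Y n ω))) ^ 2,
    ← setLIntegral_univ (μ := P) fun ω => activeHold Y τ A n ω,
    h.lintegral_eq_tsum_state n MeasurableSet.univ, h.lintegral_eq_tsum_state n MeasurableSet.univ,
    h.lintegral_eq_tsum_state n MeasurableSet.univ, ← ENNReal.tsum_mul_left, ← ENNReal.tsum_add]
  refine ENNReal.tsum_le_tsum fun S => ?_
  rw [Set.univ_inter]
  by_cases hSA : ((S : Set Vertex) ∩ A).Nonempty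
  · rw [h.setLIntegral_congr_of_meets hx₀ hq hc hb n m hSA fun x => x ^ 2]
    exact le_self_add
  by_cases hS : S.Nonempty
  · have hm := h.measurableSet_state n S
    set T := activeTime Y τ A n with hT
    set K := ENNReal.ofReal (meanTime q A (m + 1) S) with hK
    have hTm : Measurable T := h.measurable_activeTime n
    have hHm := h.measurable_comp_state (n + 1) fun S => ENNReal.ofReal (meanTime q A m S)
    have hτm := h.measurable_hold n
    have e1 := h.setLIntegral_step hq hc hb n m hS hSA (f := fun ω => 2 * T ω)
      ((measurable_activeTime_history n).const_mul 2)
    have e2 := h.setLIntegral_step_sq_le (A := A) hq hc hb hmono n m hS hSA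
    calc ∫⁻ ω in {ω | Y n ω = S}, (activeTime Y τ A (n + 1) ω +
          ENNReal.ofReal (meanTime q A m (Y (n + 1) ω))) ^ 2 ∂P
        = ∫⁻ ω in {ω | Y n ω = S}, (T ω ^ 2 +
            (2 * T ω * (τ n ω + ENNReal.ofReal (meanTime q A m (Y (n + 1) ω))) +
              (τ n ω + ENNReal.ofReal (meanTime q A m (Y (n + 1) ω))) ^ 2)) ∂P := by
          refine setLIntegral_congr_fun hm ?_
          rintro ω (rfl : Y n ω = S)
          simp only [activeTime_succ, activeHold, if_neg hSA]
          ring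
      _ = ∫⁻ ω in {ω | Y n ω = S}, T ω ^ 2 ∂P +
            ((∫⁻ ω in {ω | Y n ω = S}, 2 * T ω ∂P) * K +
              ∫⁻ ω in {ω | Y n ω = S},
                (τ n ω + ENNReal.ofReal (meanTime q A m (Y (n + 1) ω))) ^ 2 ∂P) := by
          rw [lintegral_add_left (by fun_prop), lintegral_add_left (by fun_prop), e1]
      _ ≤ ∫⁻ ω in {ω | Y n ω = S}, T ω ^ 2 ∂P +
            ((∫⁻ ω in {ω | Y n ω = S}, 2 * T ω ∂P) * K +
              (P {ω | Y n ω = S} * K ^ 2 +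
                ENNReal.ofReal (1 / c) * ∫⁻ ω in {ω | Y n ω = S}, τ n ω ∂P)) := by gcongr
      _ = ∫⁻ ω in {ω | Y n ω = S}, (T ω ^ 2 + (2 * T ω * K + K ^ 2)) ∂P +
            ENNReal.ofReal (1 / c) * ∫⁻ ω in {ω | Y n ω = S}, τ n ω ∂P := by
          rw [lintegral_add_left (by fun_prop), lintegral_add_left (by fun_prop),
            lintegral_mul_const _ (by fun_prop), setLIntegral_const]
          ring
      _ = _ := by
          congr 1
          · refine setLIntegral_congr_fun hm ?_
            rintro ω (rfl : Y n ω = S)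
            simp only [hK]
            ring
          · congr 1
            refine setLIntegral_congr_fun hm ?_
            rintro ω (rfl : Y n ω = S)
            simp only [activeHold, if_neg hSA]
  · have h0 : P {ω | Y n ω = S} = 0 := by
      refine measure_eq_zero_iff_ae_notMem.2 ?_
      filter_upwards [h.ae_growth hx₀ hq hc hb] with ω hω (hS' : Y n ω = S)
      exact hS (hS' ▸ (hω n).1)
    rw [setLIntegral_measure_zero _ _ h0]
    exact zero_le

lemma IsJumpHolding.lintegral_martingale (h : IsJumpHolding P q x₀ Y τ) (hx₀ : x₀.Nonempty)
    (hq : IsGrowthRate q) (hc : 0 < c) (hb : RatesBounded q c C) (n m : ℕ) :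
    ∫⁻ ω, (activeTime Y τ A n ω + ENNReal.ofReal (meanTime q A m (Y n ω))) ∂P =
      ENNReal.ofReal (meanTime q A (n + m) x₀) := by
  induction n generalizing m with
  | zero =>
    rw [lintegral_congr_ae (g := fun _ => ENNReal.ofReal (meanTime q A (0 + m) x₀))]
    · simp
    · filter_upwards [h.init] with ω hω
      simp [activeTime, hω]
  | succ n ih =>
    rw [h.lintegral_martingale_step hx₀ hq hc hb, ih, add_right_comm, add_assoc]

lemma IsJumpHolding.lintegral_activeTime (h : IsJumpHolding P q x₀ Y τ) (hx₀ : x₀.Nonempty)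
    (hq : IsGrowthRate q) (hc : 0 < c) (hb : RatesBounded q c C) (n : ℕ) :
    ∫⁻ ω, activeTime Y τ A n ω ∂P = ENNReal.ofReal (meanTime q A n x₀) := by
  simpa [meanTime] using h.lintegral_martingale (A := A) hx₀ hq hc hb n 0

lemma IsJumpHolding.lintegral_martingale_sq_le (h : IsJumpHolding P q x₀ Y τ) (hx₀ : x₀.Nonempty)
    (hq : IsGrowthRate q) (hc : 0 < c) (hb : RatesBounded q c C) (hmono : RatesMonotone q)
    (n m : ℕ) :
    ∫⁻ ω, (activeTime Y τ A n ω + ENNReal.ofReal (meanTime q A m (Y n ω))) ^ 2 ∂P ≤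
      ENNReal.ofReal (meanTime q A (n + m) x₀) ^ 2 +
        ENNReal.ofReal (1 / c) * ∫⁻ ω, activeTime Y τ A n ω ∂P := by
  induction n generalizing m with
  | zero =>
    rw [lintegral_congr_ae (g := fun _ => ENNReal.ofReal (meanTime q A (0 + m) x₀) ^ 2)]
    · simp
    · filter_upwards [h.init] with ω hω
      simp [activeTime, hω]
  | succ n ih =>
    refine (h.lintegral_martingale_step_sq_le hx₀ hq hc hb hmono n m).trans ?_
    simp_rw [activeTime_succ]
    rw [lintegral_add_left (h.measurable_activeTime n), mul_add, ← add_assoc, add_right_comm n 1 m]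
    gcongr
    exact ih (m + 1)

/-- At `m = 0` the mean remaining time vanishes, so the martingale ends at the active time, and its
deterministic starting value is the mean of that time. -/
lemma IsJumpHolding.lintegral_activeTime_sq_le (h : IsJumpHolding P q x₀ Y τ) (hx₀ : x₀.Nonempty)
    (hq : IsGrowthRate q) (hc : 0 < c) (hb : RatesBounded q c C) (hmono : RatesMonotone q)
    (n : ℕ) :
    ∫⁻ ω, activeTime Y τ A n ω ^ 2 ∂P ≤ (∫⁻ ω, activeTime Y τ A n ω ∂P) ^ 2 +
      ENNReal.ofReal (1 / c) * ∫⁻ ω, activeTime Y τ A n ω ∂P := by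
  have := h.lintegral_martingale_sq_le (A := A) hx₀ hq hc hb hmono n 0
  simpa [meanTime, h.lintegral_activeTime hx₀ hq hc hb] using this

end ActiveTime

/-! ### From the active time to the hitting time -/

section HittingTime

variable {Ω : Type*} {mΩ : MeasurableSpace Ω} {P : Measure Ω}
  {q : Finset Vertex → Finset Vertex → ℝ} {c C : ℝ} {A : Set Vertex} {x₀ : Finset Vertex}
  {Y : ℕ → Ω → Finset Vertex} {τ : ℕ → Ω → ℝ≥0∞}

lemma tsum_activeHold (ω : Ω) : ∑' n, activeHold Y τ A n ω = ⨆ n, activeTime Y τ A n ω :=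
  ENNReal.tsum_eq_iSup_nat

lemma monotone_activeTime : Monotone (activeTime Y τ A) := fun _ _ hmn _ =>
  Finset.sum_le_sum_of_subset (Finset.range_mono hmn)

lemma IsJumpHolding.lintegral_tsum_activeHold (h : IsJumpHolding P q x₀ Y τ) :
    ∫⁻ ω, ∑' n, activeHold Y τ A n ω ∂P = ⨆ n, ∫⁻ ω, activeTime Y τ A n ω ∂P := by
  simp_rw [tsum_activeHold]
  exact lintegral_iSup h.measurable_activeTime monotone_activeTime

variable [IsProbabilityMeasure P]

lemma IsJumpHolding.lintegral_tsum_activeHold_sq_le (h : IsJumpHolding P q x₀ Y τ)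
    (hx₀ : x₀.Nonempty) (hq : IsGrowthRate q) (hc : 0 < c) (hb : RatesBounded q c C)
    (hmono : RatesMonotone q) :
    ∫⁻ ω, (∑' n, activeHold Y τ A n ω) ^ 2 ∂P ≤
      (∫⁻ ω, ∑' n, activeHold Y τ A n ω ∂P) ^ 2 +
        ENNReal.ofReal (1 / c) * ∫⁻ ω, ∑' n, activeHold Y τ A n ω ∂P := by
  rw [h.lintegral_tsum_activeHold]
  simp_rw [tsum_activeHold, ENNReal.iSup_pow_of_ne_zero two_ne_zero]
  rw [lintegral_iSup (fun n => (h.measurable_activeTime n).pow_const 2)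
    fun m n hmn ω => pow_le_pow_left' (monotone_activeTime hmn ω) 2]
  refine iSup_le fun n => (h.lintegral_activeTime_sq_le hx₀ hq hc hb hmono n).trans ?_
  have := le_iSup (fun n => ∫⁻ ω, activeTime Y τ A n ω ∂P) n
  exact add_le_add ((pow_le_pow_left' this 2).trans_eq
    (ENNReal.iSup_pow_of_ne_zero two_ne_zero _)) (mul_le_mul_right this _)

lemma IsJumpHolding.lintegral_tsum_activeHold_lt_top (h : IsJumpHolding P q x₀ Y τ)
    (hx₀ : x₀.Nonempty) (hq : IsGrowthRate q) (hc : 0 < c) (hb : RatesBounded q c C)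
    (hmono : RatesMonotone q) (hA : A.Nonempty) :
    ∫⁻ ω, ∑' n, activeHold Y τ A n ω ∂P < ∞ := by
  obtain ⟨a, ha⟩ := hA
  obtain ⟨u, hu⟩ := hx₀
  rw [h.lintegral_tsum_activeHold]
  refine lt_of_le_of_lt (iSup_le fun n => ?_)
    (ENNReal.ofReal_lt_top (r := ((|u.1 - a.1| + |u.2 - a.2|).toNat : ℝ) / c))
  rw [h.lintegral_activeTime ⟨u, hu⟩ hq hc hb]
  exact ENNReal.ofReal_le_ofReal (meanTime_le hq hc hb hmono ha _ n hu
    (Int.toNat_of_nonneg (by positivity)).symm)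

/-- After n jumps the set has `x₀.card + n` vertices, hence at most four times as many boundary
vertices, each added at rate at most `C`. -/
lemma IsJumpHolding.le_lintegral_activeHold (h : IsJumpHolding P q x₀ Y τ) (hx₀ : x₀.Nonempty)
    (hq : IsGrowthRate q) (hc : 0 < c) (hb : RatesBounded q c C) (hC : 0 < C) (n : ℕ) :
    P {ω | ¬ ((Y n ω : Set Vertex) ∩ A).Nonempty} *
        ENNReal.ofReal (1 / (4 * C * (x₀.card + n : ℕ))) ≤ ∫⁻ ω, activeHold Y τ A n ω ∂P := by
  have hm : MeasurableSet {ω | ¬ ((Y n ω : Set Vertex) ∩ A).Nonempty} :=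
    h.measurable_state n
      (show MeasurableSet[⊤] {S : Finset Vertex | ¬ ((S : Set Vertex) ∩ A).Nonempty} from trivial)
  rw [← setLIntegral_univ (μ := P) fun ω => activeHold Y τ A n ω,
    h.lintegral_eq_tsum_state n MeasurableSet.univ, h.measure_eq_tsum_state n hm,
    ← ENNReal.tsum_mul_right]
  refine ENNReal.tsum_le_tsum fun S => ?_
  rw [Set.univ_inter]
  by_cases hSA : ((S : Set Vertex) ∩ A).Nonempty
  · have : {ω | ¬ ((Y n ω : Set Vertex) ∩ A).Nonempty} ∩ {ω | Y n ω = S} = ∅ := by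
      ext ω
      simp only [Set.mem_inter_iff, Set.mem_ofPred_eq, Set.mem_empty_iff_false, iff_false, not_and]
      rintro hω rfl
      exact hω hSA
    simp [this]
  by_cases hS : S.Nonempty ∧ S.card = x₀.card + n
  · have e1 : ∫⁻ ω in {ω | Y n ω = S}, activeHold Y τ A n ω ∂P =
        ∫⁻ ω in {ω | Y n ω = S}, τ n ω ∂P := by
      refine setLIntegral_congr_fun (h.measurableSet_state n S) ?_
      rintro ω (rfl : Y n ω = S)
      simp only [activeHold, if_neg hSA]
    rw [e1, h.setLIntegral_hold hq hc hb n hS.1, ← hS.2]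
    refine mul_le_mul' (measure_mono Set.inter_subset_right) (ENNReal.ofReal_le_ofReal ?_)
    exact one_div_le_one_div_of_le (exitRate_pos hq hc hb hS.1) (exitRate_le hq hC.le hb S)
  · have h0 : P ({ω | ¬ ((Y n ω : Set Vertex) ∩ A).Nonempty} ∩ {ω | Y n ω = S}) = 0 := by
      refine measure_mono_null Set.inter_subset_right (measure_eq_zero_iff_ae_notMem.2 ?_)
      filter_upwards [h.ae_growth hx₀ hq hc hb] with ω hω (hS' : Y n ω = S)
      exact hS (hS' ▸ ⟨(hω n).1, (hω n).2.1⟩)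
    rw [h0, zero_mul]
    exact zero_le

lemma tsum_ofReal_one_div_eq_top {b : ℝ} (hb : 0 < b) (k : ℕ) :
    ∑' n : ℕ, ENNReal.ofReal (1 / (b * (k + n : ℕ))) = ∞ := by
  by_contra hne
  have h1 := ENNReal.summable_toReal hne
  have h2 : ∀ n : ℕ, (ENNReal.ofReal (1 / (b * (k + n : ℕ)))).toReal =
      b⁻¹ * (1 / ((n + k : ℕ) : ℝ)) := fun n => by
    rw [ENNReal.toReal_ofReal (by positivity), add_comm k n, one_div, one_div, mul_inv]
  simp_rw [h2] at h1
  rw [summable_mul_left_iff (inv_ne_zero hb.ne')] at h1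
  exact Real.not_summable_one_div_natCast
    ((summable_nat_add_iff (f := fun n : ℕ => 1 / (n : ℝ)) k).1 h1)

/-- If A were missed forever with positive probability, the mean active holding times would dominate
a multiple of a harmonic series, against the finite mean of the total active time. -/
lemma IsJumpHolding.ae_exists_meets (h : IsJumpHolding P q x₀ Y τ)
    (hx₀ : x₀.Nonempty) (hq : IsGrowthRate q) (hc : 0 < c) (hb : RatesBounded q c C)
    (hmono : RatesMonotone q) (hA : A.Nonempty) :
    ∀ᵐ ω ∂P, ∃ n, ((Y n ω : Set Vertex) ∩ A).Nonempty := by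
  obtain ⟨v, hv⟩ := boundary_nonempty hx₀
  have hbv := hb x₀ v (mem_boundary.1 hv)
  have hC : 0 < C := hc.trans_le (hbv.1.trans hbv.2)
  rw [ae_iff]
  by_contra hne
  have hfin := h.lintegral_tsum_activeHold_lt_top hx₀ hq hc hb hmono hA
  rw [lintegral_tsum fun n => (h.measurable_activeHold n).aemeasurable] at hfin
  refine hfin.ne (top_unique ?_)
  calc ∞ = P {ω | ¬ ∃ n, ((Y n ω : Set Vertex) ∩ A).Nonempty} *
        ∑' n : ℕ, ENNReal.ofReal (1 / (4 * C * (x₀.card + n : ℕ))) := by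
        rw [tsum_ofReal_one_div_eq_top (by positivity), ENNReal.mul_top hne]
    _ ≤ ∑' n, ∫⁻ ω, activeHold Y τ A n ω ∂P := by
        rw [← ENNReal.tsum_mul_left]
        refine ENNReal.tsum_le_tsum fun n =>
          le_trans ?_ (h.le_lintegral_activeHold hx₀ hq hc hb hC n)
        gcongr
        exact fun hn => ⟨n, hn⟩

/-- Both sides equal the time of the n-th jump, where Y n is the first state meeting A. Everything
happens before a possible explosion, so the behaviour of `Z` afterwards is irrelevant. -/
lemma IsJumpHolding.ae_hitTime_eq (h : IsJumpHolding P q x₀ Y τ)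
    (hx₀ : x₀.Nonempty) (hq : IsGrowthRate q) (hc : 0 < c) (hb : RatesBounded q c C)
    (hmono : RatesMonotone q) (hA : A.Nonempty) {Z : ℝ≥0 → Ω → Finset Vertex}
    (hZ : ∀ᵐ ω ∂P, ∀ (n : ℕ) (t : ℝ≥0), ∑ k ∈ Finset.range n, τ k ω ≤ t →
      t < ∑ k ∈ Finset.range (n + 1), τ k ω → Z t ω = Y n ω) :
    ∀ᵐ ω ∂P, hitTime Z A ω = ∑' n, activeHold Y τ A n ω := by
  classical
  have hlt : ∀ᵐ ω ∂P, ∑' n, activeHold Y τ A n ω < ∞ :=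
    ae_lt_top (Measurable.tsum fun n => h.measurable_activeHold n)
      (h.lintegral_tsum_activeHold_lt_top hx₀ hq hc hb hmono hA).ne
  filter_upwards [hZ, hlt, h.ae_exists_meets hx₀ hq hc hb hmono hA, h.ae_growth hx₀ hq hc hb]
    with ω hZω hltω hex hgrow
  set n := Nat.find hex with hn
  have hmeets : ∀ k, n ≤ k → ((Y k ω : Set Vertex) ∩ A).Nonempty := by
    intro k hk
    induction k, hk using Nat.le_induction with
    | base => exact Nat.find_spec hex
    | succ k _ ih =>
      obtain ⟨-, -, -, v, -, hY⟩ := hgrow k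
      exact hY ▸ meets_insert ih v
  have hnot : ∀ k < n, ¬ ((Y k ω : Set Vertex) ∩ A).Nonempty := fun k hk => Nat.find_min hex hk
  have hsum : ∑' k, activeHold Y τ A k ω = ∑ k ∈ Finset.range n, τ k ω := by
    rw [tsum_eq_sum (s := Finset.range n)]
    · exact Finset.sum_congr rfl fun k hk => if_neg (hnot k (Finset.mem_range.1 hk))
    · exact fun k hk => if_pos (hmeets k (not_lt.1 fun h' => hk (Finset.mem_range.2 h')))
  rw [hsum] at hltω ⊢
  apply le_antisymm
  · have hcoe : ((∑ k ∈ Finset.range n, τ k ω).toNNReal : ℝ≥0∞) = ∑ k ∈ Finset.range n, τ k ω :=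
      ENNReal.coe_toNNReal hltω.ne
    refine (iInf₂_le (∑ k ∈ Finset.range n, τ k ω).toNNReal ?_).trans hcoe.le
    -- The positive holding time ensures that `Z` equals `Y n` at the very moment of the n-th jump,
    -- so the infimum is attained.
    have hlast : ∑ k ∈ Finset.range n, τ k ω < ∑ k ∈ Finset.range (n + 1), τ k ω := by
      rw [Finset.sum_range_succ]
      exact ENNReal.lt_add_right hltω.ne (hgrow n).2.2.1.ne'
    have hZt := hZω n _ hcoe.ge (hcoe.trans_lt hlast)
    simp only [Set.mem_ofPred_eq, hZt]
    exact hmeets n le_rfl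
  · refine le_iInf₂ fun t ht => ?_
    by_contra! hlt'
    -- The first partial sum exceeding `t` has index `k + 1`, so `Y k` is the state occupied at `t`,
    -- with `k < n`.
    have hex' : ∃ k, (t : ℝ≥0∞) < ∑ i ∈ Finset.range k, τ i ω := ⟨n, hlt'⟩
    obtain ⟨k, hk⟩ : ∃ k, Nat.find hex' = k + 1 := by
      refine Nat.exists_eq_succ_of_ne_zero fun h0 => ?_
      have := Nat.find_spec hex'
      rw [h0] at this
      simp at this
    have h1 : (t : ℝ≥0∞) < ∑ i ∈ Finset.range (k + 1), τ i ω := hk ▸ Nat.find_spec hex'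
    have h2 : ∑ i ∈ Finset.range k, τ i ω ≤ t :=
      not_lt.1 (Nat.find_min hex' (hk ▸ k.lt_succ_self))
    have hkn : k < n := by
      have := Nat.find_min' hex' hlt'
      omega
    have hmeet : ((Z t ω : Set Vertex) ∩ A).Nonempty := ht
    rw [hZω k t h2 h1] at hmeet
    exact hnot k hkn hmeet

end HittingTime

end MarkovGrowth

/-! ### Passage to real-valued moments -/

theorem mainTheorem6
    {Ω : Type*} [MeasurableSpace Ω] (P : Measure Ω) [IsProbabilityMeasure P]
    (q : Finset MarkovGrowth.Vertex → Finset MarkovGrowth.Vertex → ℝ)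
    (c C : ℝ) (hc : 0 < c)
    (hq : MarkovGrowth.IsGrowthRate q)
    (hbound : MarkovGrowth.RatesBounded q c C)
    (hmono : MarkovGrowth.RatesMonotone q)
    (Z : ℝ≥0 → Ω → Finset MarkovGrowth.Vertex)
    (hZ : MarkovGrowth.IsMarkovChain P q {(0, 0)} Z)
    (A : Set MarkovGrowth.Vertex) (hA : A ⊆ {(0, 0)}ᶜ) (hne : A.Nonempty) :
    (∀ᵐ ω ∂P, MarkovGrowth.hitTime Z A ω < ∞) ∧
      MemLp (fun ω => (MarkovGrowth.hitTime Z A ω).toReal) 2 P ∧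
      variance (fun ω => (MarkovGrowth.hitTime Z A ω).toReal) P ≤
        (∫ ω, (MarkovGrowth.hitTime Z A ω).toReal ∂P) / c := by
  obtain ⟨Y, τ, h, hZ⟩ := hZ
  have hx₀ : ({(0, 0)} : Finset MarkovGrowth.Vertex).Nonempty := Finset.singleton_nonempty _
  set T : Ω → ℝ≥0∞ := fun ω => ∑' n, MarkovGrowth.activeHold Y τ A n ω with hT
  have hTm : Measurable T := Measurable.tsum fun n => h.measurable_activeHold n
  have hI1 : ∫⁻ ω, T ω ∂P < ∞ := h.lintegral_tsum_activeHold_lt_top hx₀ hq hc hbound hmono hne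
  have hI2 : ∫⁻ ω, T ω ^ 2 ∂P ≤ (∫⁻ ω, T ω ∂P) ^ 2 + ENNReal.ofReal (1 / c) * ∫⁻ ω, T ω ∂P :=
    h.lintegral_tsum_activeHold_sq_le hx₀ hq hc hbound hmono
  have hI2' : (∫⁻ ω, T ω ∂P) ^ 2 + ENNReal.ofReal (1 / c) * ∫⁻ ω, T ω ∂P ≠ ∞ :=
    ENNReal.add_ne_top.2 ⟨ENNReal.pow_ne_top hI1.ne,
      ENNReal.mul_ne_top ENNReal.ofReal_ne_top hI1.ne⟩
  have hTlt : ∀ᵐ ω ∂P, T ω < ∞ := ae_lt_top hTm hI1.ne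
  have heq : ∀ᵐ ω ∂P, MarkovGrowth.hitTime Z A ω = T ω :=
    h.ae_hitTime_eq hx₀ hq hc hbound hmono hne hZ
  have heq' : (fun ω => (MarkovGrowth.hitTime Z A ω).toReal) =ᵐ[P] fun ω => (T ω).toReal :=
    heq.mono fun ω hω => congrArg ENNReal.toReal hω
  have hmean : ∫ ω, (T ω).toReal ∂P = (∫⁻ ω, T ω ∂P).toReal :=
    integral_toReal hTm.aemeasurable hTlt
  have hsq : ∫ ω, (T ω).toReal ^ 2 ∂P = (∫⁻ ω, T ω ^ 2 ∂P).toReal := by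
    simp_rw [← ENNReal.toReal_pow]
    exact integral_toReal (hTm.pow_const 2).aemeasurable
      (hTlt.mono fun ω hω => ENNReal.pow_lt_top hω)
  have hTr : AEStronglyMeasurable (fun ω => (T ω).toReal) P :=
    hTm.ennreal_toReal.aestronglyMeasurable
  have hmem : MemLp (fun ω => (T ω).toReal) 2 P := by
    rw [memLp_two_iff_integrable_sq hTr]
    simp_rw [← ENNReal.toReal_pow]
    exact integrable_toReal_of_lintegral_ne_top (hTm.pow_const 2).aemeasurable
      (ne_top_of_le_ne_top hI2' hI2)
  refine ⟨?_, (memLp_congr_ae heq').2 hmem, ?_⟩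
  · filter_upwards [heq, hTlt] with ω h1 h2
    rwa [h1]
  · rw [variance_congr heq', integral_congr_ae heq', variance_eq_sub hmem]
    simp only [Pi.pow_apply]
    rw [hsq, hmean]
    -- The second-moment bound is E T² ≤ (E T)² + E T / c; subtracting (E T)² gives the variance.
    have := ENNReal.toReal_mono hI2' hI2
    rw [ENNReal.toReal_add (ENNReal.pow_ne_top hI1.ne)
        (ENNReal.mul_ne_top ENNReal.ofReal_ne_top hI1.ne), ENNReal.toReal_pow, ENNReal.toReal_mul,
      ENNReal.toReal_ofReal (by positivity), one_div_mul_eq_div] at this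
    linarith
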